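/- Let $d\ge 2$ be an integer. Let $\Pi_\wedge$ be the Hermitian projector onto the antisymmetric subspace $\{v\in\mathbb{C}^d\otimes\mathbb{C}^d : \mathrm{SWAP}\,v=-v\}$, let $\tau_d=\frac{2}{d(d-1)}\Pi_\wedge$ be the antisymmetric Werner state, shared by Alice and Bob on $\mathcal{H}_{R_A}\otimes\mathcal{H}_{R_B}=\mathbb{C}^d\otimes\mathbb{C}^d$, and let $\psi_-$ be the density operator of the singlet $\frac{1}{\sqrt2}(|01\rangle-|10\rangle)\in\mathcal{H}_A\otimes\mathcal{H}_B=\mathbb{C}^2\otimes\mathbb{C}^2$. The Choi operator of a linear map $\mathcal{E}$ is $\sum_{i,j}|i\rangle\langle j|\otimes\mathcal{E}(|i\rangle\langle j|)$. A pair $(\mathcal{S}_{\rm succ},\mathcal{S}_{\rm fail})$ of completely positive maps from operators on $\mathcal{H}_{R_A}\otimes\mathcal{H}_{R_B}$ to operators on $\mathcal{H}_A\otimes\mathcal{H}_B$ whose sum is trace preserving is called separable (SEP) if the Choi operators of both maps are finite sums $\sum_x|a_x\rangle\langle a_x|\otimes|b_x\rangle\langle b_x|$ with $a_x\in\mathcal{H}_{R_A}\otimes\mathcal{H}_A$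 and $b_x\in\mathcal{H}_{R_B}\otimes\mathcal{H}_B$. It is called PPT if both Choi operators are positive semidefinite and all their partial transposes with respect to the bipartition $R_AA:R_BB$ are positive semidefinite. Such a pair distils $\psi_-$ from $\tau_d$ with zero error and success probability $p\in\mathbb{R}$ if $\mathcal{S}_{\rm succ}(\tau_d)=p\,\psi_-$. Then the maximum success probability of zero-error distillation of $\psi_-$ from $\tau_d$ exists in both cases. Over separable pairs it equals $\frac{1}{d-1}$, and over PPT pairs it equals $\frac{2}{d}$. -/

import Mathlib

open scoped ComplexOrder Kronecker

noncomputable section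

namespace EntDist

/-- The (unnormalized) product vector `|a⟩ ⊗ |b⟩`, written in the computational basis. -/
def prodVec {α β : Type*} (a : α → ℂ) (b : β → ℂ) : α × β → ℂ :=
  fun x => a x.1 * b x.2

/-- The rank-one operator `|v⟩⟨v|`. -/
def ketbra {ι : Type*} (v : ι → ℂ) : Matrix ι ι ℂ :=
  Matrix.vecMulVec v (star v)

/-- The separable cone `SEP(α : β)`: finite sums of `|Π⟩⟨Π|` with `|Π⟩` a product vector. -/
def sepCone (α β : Type*) : Set (Matrix (α × β) (α × β) ℂ) :=
  {S | ∃ (n : ℕ) (a : Fin n → α → ℂ) (b : Fin n → β → ℂ),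
    S = ∑ k, ketbra (prodVec (a k) (b k))}

/-- Partial transpose on the first tensor factor. -/
def partialTransposeLeft {α β : Type*} (M : Matrix (α × β) (α × β) ℂ) :
    Matrix (α × β) (α × β) ℂ :=
  Matrix.of fun x y => M (y.1, x.2) (x.1, y.2)

/-- Partial transpose on the second tensor factor. -/
def partialTransposeRight {α β : Type*} (M : Matrix (α × β) (α × β) ℂ) :
    Matrix (α × β) (α × β) ℂ :=
  Matrix.of fun x y => M (x.1, y.2) (y.1, x.2)

/-- The PPT cone `PPT(α : β)`: positive semidefinite operators all of whose partial transposes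
(on no factor, the first, the second, or both factors) are positive semidefinite. -/
def pptCone (α β : Type*) : Set (Matrix (α × β) (α × β) ℂ) :=
  {P | P.PosSemidef ∧ (partialTransposeLeft P).PosSemidef ∧
    (partialTransposeRight P).PosSemidef ∧ P.transpose.PosSemidef}

/-- The Choi operator `∑ i j, |i⟩⟨j| ⊗ E(|i⟩⟨j|)` of a linear map `E`. -/
def choi {ι κ : Type*} [Fintype ι] [DecidableEq ι]
    (E : Matrix ι ι ℂ →ₗ[ℂ] Matrix κ κ ℂ) : Matrix (ι × κ) (ι × κ) ℂ :=
  ∑ i, ∑ j, Matrix.single i j (1 : ℂ) ⊗ₖ E (Matrix.single i j (1 : ℂ))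

theorem choi_apply {ι κ : Type*} [Fintype ι] [DecidableEq ι]
    (E : Matrix ι ι ℂ →ₗ[ℂ] Matrix κ κ ℂ) (i j : ι) (k l : κ) :
    choi E (i, k) (j, l) = E (Matrix.single i j 1) k l := by
  simp [choi, Matrix.sum_apply, Matrix.kroneckerMap_apply, Matrix.single_apply, ite_and,
    Finset.sum_ite_eq']

/-- For a map from operators on `H_{A₁} ⊗ H_{B₁}` to operators on `H_{A₂} ⊗ H_{B₂}`, the Choi
operator with the tensor factors regrouped as `(H_{A₁} ⊗ H_{A₂}) ⊗ (H_{B₁} ⊗ H_{B₂})`, that is,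
Alice's systems against Bob's systems. -/
def bipartiteChoi {A₁ B₁ A₂ B₂ : Type*} [Fintype A₁] [Fintype B₁]
    [DecidableEq A₁] [DecidableEq B₁]
    (E : Matrix (A₁ × B₁) (A₁ × B₁) ℂ →ₗ[ℂ] Matrix (A₂ × B₂) (A₂ × B₂) ℂ) :
    Matrix ((A₁ × A₂) × (B₁ × B₂)) ((A₁ × A₂) × (B₁ × B₂)) ℂ :=
  Matrix.reindex (Equiv.prodProdProdComm A₁ B₁ A₂ B₂) (Equiv.prodProdProdComm A₁ B₁ A₂ B₂)
    (choi E)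

/-- A quantum instrument: completely positive maps (positive semidefinite Choi operators) whose
sum is trace preserving. -/
structure IsInstrument {M ι κ : Type*} [Fintype M] [Fintype ι] [DecidableEq ι] [Fintype κ]
    (E : M → (Matrix ι ι ℂ →ₗ[ℂ] Matrix κ κ ℂ)) : Prop where
  completelyPositive : ∀ m, (choi (E m)).PosSemidef
  tracePreserving : ∀ X : Matrix ι ι ℂ, (∑ m, E m X).trace = X.trace

/-- A separable instrument: every Choi operator lies in the separable cone. -/
structure IsSepInstrument {M A₁ B₁ A₂ B₂ : Type*} [Fintype M] [Fintype A₁] [Fintype B₁]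
    [DecidableEq A₁] [DecidableEq B₁] [Fintype A₂] [Fintype B₂]
    (E : M → (Matrix (A₁ × B₁) (A₁ × B₁) ℂ →ₗ[ℂ] Matrix (A₂ × B₂) (A₂ × B₂) ℂ)) : Prop where
  isInstrument : IsInstrument E
  separable : ∀ m, bipartiteChoi (E m) ∈ sepCone (A₁ × A₂) (B₁ × B₂)

/-- A PPT instrument: every Choi operator lies in the PPT cone. -/
structure IsPPTInstrument {M A₁ B₁ A₂ B₂ : Type*} [Fintype M] [Fintype A₁] [Fintype B₁]
    [DecidableEq A₁] [DecidableEq B₁] [Fintype A₂] [Fintype B₂]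
    (E : M → (Matrix (A₁ × B₁) (A₁ × B₁) ℂ →ₗ[ℂ] Matrix (A₂ × B₂) (A₂ × B₂) ℂ)) : Prop where
  isInstrument : IsInstrument E
  ppt : ∀ m, bipartiteChoi (E m) ∈ pptCone (A₁ × A₂) (B₁ × B₂)

/-- The success probabilities `p` of zero-error distillation of `ψ` from `τ` by a separable
instrument with outcomes success (`true`) and failure (`false`): on success the output is exactly
`ψ`, and this occurs with probability `p`. -/
def sepSuccessProbs {R_A R_B A B : Type*} [Fintype R_A] [Fintype R_B] [DecidableEq R_A]
    [DecidableEq R_B] [Fintype A] [Fintype B]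
    (τ : Matrix (R_A × R_B) (R_A × R_B) ℂ) (ψ : Matrix (A × B) (A × B) ℂ) : Set ℝ :=
  {p | ∃ E : Bool → (Matrix (R_A × R_B) (R_A × R_B) ℂ →ₗ[ℂ] Matrix (A × B) (A × B) ℂ),
    IsSepInstrument E ∧ E true τ = (p : ℂ) • ψ}

/-- The same with PPT instruments in place of separable ones. -/
def pptSuccessProbs {R_A R_B A B : Type*} [Fintype R_A] [Fintype R_B] [DecidableEq R_A]
    [DecidableEq R_B] [Fintype A] [Fintype B]
    (τ : Matrix (R_A × R_B) (R_A × R_B) ℂ) (ψ : Matrix (A × B) (A × B) ℂ) : Set ℝ :=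
  {p | ∃ E : Bool → (Matrix (R_A × R_B) (R_A × R_B) ℂ →ₗ[ℂ] Matrix (A × B) (A × B) ℂ),
    IsPPTInstrument E ∧ E true τ = (p : ℂ) • ψ}

/-- The SWAP operator `|i⟩|j⟩ ↦ |j⟩|i⟩` on `ℂ^d ⊗ ℂ^d`. -/
def swapOp (d : ℕ) : Matrix (Fin d × Fin d) (Fin d × Fin d) ℂ :=
  Matrix.of fun x y => if x = y.swap then 1 else 0

/-- The Hermitian projector onto the antisymmetric subspace of `ℂ^d ⊗ ℂ^d`. -/
def antisymProj (d : ℕ) : Matrix (Fin d × Fin d) (Fin d × Fin d) ℂ :=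
  (1 / 2 : ℂ) • (1 - swapOp d)

theorem swapOp_mul_self (d : ℕ) : swapOp d * swapOp d = 1 := by
  ext x y
  rw [Matrix.mul_apply, Finset.sum_eq_single y.swap]
  · simp [swapOp, Matrix.one_apply]
  · intro z _ hz
    simp [swapOp, hz]
  · simp

theorem swapOp_isHermitian (d : ℕ) : (swapOp d).IsHermitian := by
  ext x y
  have h : y = x.swap ↔ x = y.swap :=
    ⟨fun h => by rw [h, Prod.swap_swap], fun h => by rw [h, Prod.swap_swap]⟩
  by_cases hx : x = y.swap
  · simp only [swapOp, Matrix.conjTranspose_apply, Matrix.of_apply, if_pos hx, if_pos (h.2 hx),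
      star_one]
  · have hy : ¬ y = x.swap := fun e => hx (h.1 e)
    simp only [swapOp, Matrix.conjTranspose_apply, Matrix.of_apply, if_neg hx, if_neg hy,
      star_zero]

theorem antisymProj_isHermitian (d : ℕ) : (antisymProj d).IsHermitian := by
  unfold antisymProj Matrix.IsHermitian
  rw [Matrix.conjTranspose_smul, Matrix.conjTranspose_sub, Matrix.conjTranspose_one,
    swapOp_isHermitian d]
  simp

theorem antisymProj_mul_self (d : ℕ) : antisymProj d * antisymProj d = antisymProj d := by
  unfold antisymProj
  rw [Matrix.smul_mul, Matrix.mul_smul, smul_smul, Matrix.sub_mul, Matrix.mul_sub,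
    Matrix.mul_sub, swapOp_mul_self]
  simp only [Matrix.one_mul, Matrix.mul_one]
  module

/-- The vectors fixed by `antisymProj` are exactly the antisymmetric ones, `SWAP v = -v`. -/
theorem antisymProj_mulVec_eq_self_iff (d : ℕ) (v : Fin d × Fin d → ℂ) :
    (antisymProj d).mulVec v = v ↔ (swapOp d).mulVec v = -v := by
  unfold antisymProj
  rw [Matrix.smul_mulVec, Matrix.sub_mulVec, Matrix.one_mulVec]
  constructor <;> intro h
  · have h2 := congrArg (fun w => (2 : ℂ) • w) h
    simp only [smul_smul] at h2
    norm_num [two_smul] at h2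
    rw [sub_eq_iff_eq_add] at h2
    linear_combination (exp := 1) -h2
  · rw [h]
    module

/-- The antisymmetric Werner state: `antisymProj` divided by the dimension `d(d-1)/2` of the
antisymmetric subspace. -/
def wernerState (d : ℕ) : Matrix (Fin d × Fin d) (Fin d × Fin d) ℂ :=
  (2 / ((d : ℂ) * ((d : ℂ) - 1))) • antisymProj d

/-- The singlet vector `(|01⟩ - |10⟩)/√2`. -/
def singletVec : Fin 2 × Fin 2 → ℂ :=
  fun x => if x = (0, 1) then ((1 / Real.sqrt 2 : ℝ) : ℂ)
    else if x = (1, 0) then -((1 / Real.sqrt 2 : ℝ) : ℂ) else 0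

/-- The singlet state `|ψ₋⟩⟨ψ₋|`. -/
def singlet : Matrix (Fin 2 × Fin 2) (Fin 2 × Fin 2) ℂ :=
  ketbra singletVec

end EntDist

end

/-! Write F for SWAP on the input, F' for SWAP on the output. The operator 1 - F is a multiple of
the Werner state, so a zero-error success map S satisfies S(1 - F) = d(d-1)p ψ₋. Both upper bounds
compare this with S(F). Since F is the partial transpose of the positive operator Φ = `maxEnt d`,
the failure map has nonnegative trace on F, and trace preservation gives tr S(F) ≤ tr F = d.

PPT: pairing the partially transposed Choi operator with Φ ⊗ (2 - Φ') and (d - Φ) ⊗ Φ' gives two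
more linear inequalities, and together they force p ≤ 2/d (`le_of_mem_pptSuccessProbs`). An optimal
pair is sought among combinations of 1, F and 1, F', chosen to make these inequalities tight.

SEP: each Kraus operator A ⊗ B must send antisymmetric vectors to multiples of the singlet. It then
either annihilates them all or has B proportional to A (`wedge_eq_zero_or_proportional`). In the
second case the output dimension 2 gives tr S(1 - F) ≤ tr S(F) termwise (`trace_sepTerm_smul_le`),
so d(d-1)p ≤ d. Projecting both sides onto a common random pair of basis vectors attains this. -/

noncomputable section

namespace EntDist

/-! ### Maps and their Choi operators -/

section Choi

variable {ι κ : Type*} [Fintype ι] [DecidableEq ι]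

theorem apply_eq_sum_choi (E : Matrix ι ι ℂ →ₗ[ℂ] Matrix κ κ ℂ) (X : Matrix ι ι ℂ) (k l : κ) :
    E X k l = ∑ i, ∑ j, X i j * choi E (i, k) (j, l) := by
  conv_lhs => rw [Matrix.matrix_eq_sum_single X]
  simp only [map_sum, Matrix.sum_apply, choi_apply]
  refine Finset.sum_congr rfl fun i _ => Finset.sum_congr rfl fun j _ => ?_
  rw [← mul_one (X i j), ← smul_eq_mul, ← Matrix.smul_single, map_smul, Matrix.smul_apply,
    smul_eq_mul, smul_eq_mul, mul_one]

/-- The linear map with a given Choi operator. -/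
def ofChoi (J : Matrix (ι × κ) (ι × κ) ℂ) : Matrix ι ι ℂ →ₗ[ℂ] Matrix κ κ ℂ where
  toFun X := Matrix.of fun k l => ∑ i, ∑ j, X i j * J (i, k) (j, l)
  map_add' X Y := by
    ext k l
    simp [add_mul, Finset.sum_add_distrib]
  map_smul' c X := by
    ext k l
    simp [Finset.mul_sum, mul_assoc]

theorem choi_ofChoi (J : Matrix (ι × κ) (ι × κ) ℂ) : choi (ofChoi J) = J := by
  ext ⟨i, k⟩ ⟨j, l⟩
  rw [choi_apply]
  simp [ofChoi, Matrix.single_apply, ite_and]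

omit [DecidableEq ι] in
theorem ofChoi_add (J K : Matrix (ι × κ) (ι × κ) ℂ) (X : Matrix ι ι ℂ) :
    ofChoi (J + K) X = ofChoi J X + ofChoi K X := by
  ext k l
  simp [ofChoi, mul_add, Finset.sum_add_distrib]

omit [DecidableEq ι] in
theorem ofChoi_smul (c : ℂ) (J : Matrix (ι × κ) (ι × κ) ℂ) (X : Matrix ι ι ℂ) :
    ofChoi (c • J) X = c • ofChoi J X := by
  ext k l
  simp [ofChoi, Finset.mul_sum, mul_left_comm]

omit [DecidableEq ι] in
theorem ofChoi_kronecker (A : Matrix ι ι ℂ) (B : Matrix κ κ ℂ) (X : Matrix ι ι ℂ) :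
    ofChoi (A ⊗ₖ B) X = (X * A.transpose).trace • B := by
  ext k l
  simp [ofChoi, Matrix.trace, Matrix.mul_apply, Finset.sum_mul, mul_assoc]

theorem trace_choi_mul_kronecker [Fintype κ] (E : Matrix ι ι ℂ →ₗ[ℂ] Matrix κ κ ℂ)
    (X : Matrix ι ι ℂ) (Y : Matrix κ κ ℂ) :
    (choi E * (X ⊗ₖ Y)).trace = (E X.transpose * Y).trace := by
  simp only [Matrix.trace, Matrix.diag_apply, Matrix.mul_apply, Fintype.sum_prod_type,
    Matrix.kroneckerMap_apply, apply_eq_sum_choi E, Matrix.transpose_apply, Finset.sum_mul]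
  rw [Finset.sum_comm]
  refine Finset.sum_congr rfl fun k _ => ?_
  rw [Finset.sum_comm' (t' := Finset.univ) (s' := fun _ => Finset.univ) (by simp)]
  simp only [Finset.sum_comm (s := (Finset.univ : Finset κ)) (t := (Finset.univ : Finset ι))]
  rw [Finset.sum_comm]
  refine Finset.sum_congr rfl fun i _ => Finset.sum_congr rfl fun j _ =>
    Finset.sum_congr rfl fun l _ => by ring

end Choi

/-! ### Regrouping of tensor factors and partial transposition -/

section Regroup

variable {A₁ B₁ A₂ B₂ : Type*}

/-- Regroup tensor factors as in `bipartiteChoi`. -/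
def regroup (M : Matrix ((A₁ × B₁) × (A₂ × B₂)) ((A₁ × B₁) × (A₂ × B₂)) ℂ) :
    Matrix ((A₁ × A₂) × (B₁ × B₂)) ((A₁ × A₂) × (B₁ × B₂)) ℂ :=
  Matrix.reindex (Equiv.prodProdProdComm A₁ B₁ A₂ B₂) (Equiv.prodProdProdComm A₁ B₁ A₂ B₂) M

theorem regroup_add (M N : Matrix ((A₁ × B₁) × (A₂ × B₂)) ((A₁ × B₁) × (A₂ × B₂)) ℂ) :
    regroup (M + N) = regroup M + regroup N := rfl

theorem regroup_smul (c : ℂ) (M : Matrix ((A₁ × B₁) × (A₂ × B₂)) ((A₁ × B₁) × (A₂ × B₂)) ℂ) :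
    regroup (c • M) = c • regroup M := rfl

theorem posSemidef_regroup
    {M : Matrix ((A₁ × B₁) × (A₂ × B₂)) ((A₁ × B₁) × (A₂ × B₂)) ℂ} :
    (regroup M).PosSemidef ↔ M.PosSemidef :=
  Matrix.posSemidef_submatrix_equiv _

theorem trace_regroup_mul [Fintype A₁] [Fintype B₁] [Fintype A₂] [Fintype B₂]
    (M N : Matrix ((A₁ × B₁) × (A₂ × B₂)) ((A₁ × B₁) × (A₂ × B₂)) ℂ) :
    (regroup M * regroup N).trace = (M * N).trace := by
  unfold regroup
  rw [Matrix.reindex_apply, Matrix.reindex_apply, Matrix.submatrix_mul_equiv]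
  exact Equiv.sum_comp (Equiv.prodProdProdComm A₁ B₁ A₂ B₂).symm fun x => (M * N) x x

theorem partialTransposeRight_regroup_kronecker (X : Matrix (A₁ × B₁) (A₁ × B₁) ℂ)
    (Y : Matrix (A₂ × B₂) (A₂ × B₂) ℂ) :
    partialTransposeRight (regroup (X ⊗ₖ Y)) =
      regroup (partialTransposeRight X ⊗ₖ partialTransposeRight Y) := rfl

theorem partialTransposeRight_partialTransposeRight {α β : Type*}
    (M : Matrix (α × β) (α × β) ℂ) :
    partialTransposeRight (partialTransposeRight M) = M := rfl

theorem partialTransposeRight_add {α β : Type*} (M N : Matrix (α × β) (α × β) ℂ) :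
    partialTransposeRight (M + N) = partialTransposeRight M + partialTransposeRight N := rfl

theorem partialTransposeRight_sub {α β : Type*} (M N : Matrix (α × β) (α × β) ℂ) :
    partialTransposeRight (M - N) = partialTransposeRight M - partialTransposeRight N := rfl

theorem partialTransposeRight_smul {α β : Type*} (c : ℂ) (M : Matrix (α × β) (α × β) ℂ) :
    partialTransposeRight (c • M) = c • partialTransposeRight M := rfl

theorem partialTransposeRight_one {α β : Type*} [DecidableEq α] [DecidableEq β] :
    partialTransposeRight (1 : Matrix (α × β) (α × β) ℂ) = 1 := by
  ext ⟨i, j⟩ ⟨k, l⟩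
  simp [partialTransposeRight, Matrix.one_apply, eq_comm]

theorem trace_partialTransposeRight_mul {α β : Type*} [Fintype α] [Fintype β]
    (M N : Matrix (α × β) (α × β) ℂ) :
    (partialTransposeRight M * N).trace = (M * partialTransposeRight N).trace := by
  simp only [Matrix.trace, Matrix.diag_apply, Matrix.mul_apply, Fintype.sum_prod_type,
    partialTransposeRight, Matrix.of_apply]
  simp only [Finset.sum_comm (s := (Finset.univ : Finset β)) (t := (Finset.univ : Finset α))]
  exact Finset.sum_congr rfl fun i _ => Finset.sum_congr rfl fun k _ => Finset.sum_comm

/-- Decomposing N into rank-one terms turns the trace into a sum of quadratic forms of M. -/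
theorem posSemidef_trace_mul_nonneg {n : Type*} [Fintype n] {M N : Matrix n n ℂ}
    (hM : M.PosSemidef) (hN : N.PosSemidef) : 0 ≤ (M * N).trace := by
  obtain ⟨m, v, rfl⟩ := Matrix.posSemidef_iff_eq_sum_vecMulVec.mp hN
  rw [Finset.mul_sum, Matrix.trace_sum]
  refine Finset.sum_nonneg fun x _ => ?_
  rw [Matrix.mul_vecMulVec, Matrix.trace_vecMulVec, dotProduct_comm]
  exact hM.dotProduct_mulVec_nonneg _

end Regroup

/-! ### Positivity and traces of SWAP, the maximally entangled operator and the singlet -/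

/-- The unnormalized maximally entangled operator `∑ i j, |ii⟩⟨jj|`. -/
def maxEnt (d : ℕ) : Matrix (Fin d × Fin d) (Fin d × Fin d) ℂ :=
  ketbra fun x => if x.1 = x.2 then 1 else 0

theorem partialTransposeRight_swapOp (d : ℕ) : partialTransposeRight (swapOp d) = maxEnt d := by
  ext ⟨i, j⟩ ⟨k, l⟩
  simp only [partialTransposeRight, swapOp, maxEnt, ketbra, Matrix.vecMulVec_apply,
    Matrix.of_apply, Prod.swap, Prod.mk.injEq, Pi.star_apply, apply_ite star, star_one, star_zero,
    ite_and, mul_ite, mul_one, mul_zero]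
  split_ifs <;> simp_all

theorem partialTransposeRight_maxEnt (d : ℕ) : partialTransposeRight (maxEnt d) = swapOp d := by
  rw [← partialTransposeRight_swapOp, partialTransposeRight_partialTransposeRight]

theorem maxEnt_posSemidef (d : ℕ) : (maxEnt d).PosSemidef :=
  Matrix.posSemidef_vecMulVec_self_star _

theorem maxEnt_mul_self (d : ℕ) : maxEnt d * maxEnt d = (d : ℂ) • maxEnt d := by
  rw [maxEnt, ketbra, Matrix.vecMulVec_mul_vecMulVec, Matrix.vecMulVec_smul]
  simp [dotProduct, Fintype.sum_prod_type]

/-- A is c times a projector, so A = c⁻¹ A†A. This handles 1 ± F and d - Φ uniformly. -/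
theorem posSemidef_of_mul_self_eq_smul {n : Type*} [Fintype n]
    {A : Matrix n n ℂ} (hA : A.IsHermitian) {c : ℝ} (hc : 0 < c) (h : A * A = (c : ℂ) • A) :
    A.PosSemidef := by
  have h1 : A = (c⁻¹ : ℝ) • (A.conjTranspose * A) := by
    rw [hA.eq, h, ← Complex.coe_smul, smul_smul]
    simp [hc.ne']
  rw [h1]
  exact (Matrix.posSemidef_conjTranspose_mul_self A).smul (inv_nonneg.2 hc.le)

theorem natCast_sub_maxEnt_posSemidef {d : ℕ} (hd : 0 < d) :
    ((d : ℂ) • 1 - maxEnt d).PosSemidef := by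
  refine posSemidef_of_mul_self_eq_smul (c := d) ?_ (by exact_mod_cast hd) ?_
  · refine Matrix.IsHermitian.sub ?_ (maxEnt_posSemidef d).1
    simp [Matrix.IsHermitian]
  · simp only [Matrix.sub_mul, Matrix.mul_sub, maxEnt_mul_self, Matrix.smul_mul, Matrix.mul_smul,
      Matrix.one_mul, Matrix.mul_one, Complex.ofReal_natCast]
    module

theorem one_add_swapOp_posSemidef (d : ℕ) : (1 + swapOp d).PosSemidef := by
  refine posSemidef_of_mul_self_eq_smul (c := 2) ?_ two_pos ?_
  · exact Matrix.isHermitian_one.add (swapOp_isHermitian d)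
  · simp only [Matrix.add_mul, Matrix.mul_add, swapOp_mul_self, Matrix.one_mul, Matrix.mul_one,
      Complex.ofReal_ofNat]
    module

theorem one_sub_swapOp_posSemidef (d : ℕ) : (1 - swapOp d).PosSemidef := by
  refine posSemidef_of_mul_self_eq_smul (c := 2) ?_ two_pos ?_
  · exact Matrix.isHermitian_one.sub (swapOp_isHermitian d)
  · simp only [Matrix.sub_mul, Matrix.mul_sub, swapOp_mul_self, Matrix.one_mul, Matrix.mul_one,
      Complex.ofReal_ofNat]
    module

theorem swapOp_transpose (d : ℕ) : (swapOp d).transpose = swapOp d := by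
  ext ⟨i, j⟩ ⟨k, l⟩
  simp [swapOp, and_comm, eq_comm]

theorem trace_swapOp (d : ℕ) : (swapOp d).trace = d := by
  simp only [Matrix.trace, Matrix.diag_apply, swapOp, Matrix.of_apply, Fintype.sum_prod_type,
    Prod.swap_prod_mk, Prod.mk.injEq, eq_comm, and_self]
  simp

theorem trace_one_prod (d : ℕ) : (1 : Matrix (Fin d × Fin d) (Fin d × Fin d) ℂ).trace = d * d := by
  simp [Matrix.trace_one]

theorem singlet_eq_antisymProj : singlet = antisymProj 2 := by
  have h : ((Real.sqrt 2 : ℝ) : ℂ)⁻¹ * ((Real.sqrt 2 : ℝ) : ℂ)⁻¹ = 2⁻¹ := by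
    rw [← mul_inv, ← Complex.ofReal_mul, Real.mul_self_sqrt (by norm_num)]
    norm_num
  ext ⟨i, j⟩ ⟨k, l⟩
  fin_cases i <;> fin_cases j <;> fin_cases k <;> fin_cases l <;>
    simp [singlet, ketbra, singletVec, antisymProj, swapOp, Matrix.vecMulVec_apply, h]

theorem two_smul_antisymProj (d : ℕ) : (2 : ℂ) • antisymProj d = 1 - swapOp d := by
  rw [antisymProj, smul_smul]
  norm_num

/-- A zero-error distillation map sends twice the antisymmetric projector to a multiple of the
singlet. -/
theorem apply_one_sub_swapOp {κ : Type*} {d : ℕ} (hd : 2 ≤ d)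
    {E : Matrix (Fin d × Fin d) (Fin d × Fin d) ℂ →ₗ[ℂ] Matrix κ κ ℂ} {ψ : Matrix κ κ ℂ} {p : ℝ}
    (h : E (wernerState d) = (p : ℂ) • ψ) :
    E (1 - swapOp d) = ((d : ℂ) * (d - 1) * p) • ψ := by
  have h0 : (d : ℂ) ≠ 0 := by exact_mod_cast (by lia : d ≠ 0)
  have h1 : (d : ℂ) - 1 ≠ 0 := sub_ne_zero.2 (by exact_mod_cast (by lia : d ≠ 1))
  have h2 : 1 - swapOp d = ((d : ℂ) * (d - 1)) • wernerState d := by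
    rw [wernerState, smul_smul, ← two_smul_antisymProj]
    congr 1
    field_simp
  rw [h2, map_smul, h, smul_smul]

theorem IsInstrument.trace_add {ι κ : Type*} [Fintype ι] [DecidableEq ι] [Fintype κ]
    {E : Bool → (Matrix ι ι ℂ →ₗ[ℂ] Matrix κ κ ℂ)} (hE : IsInstrument E) (X : Matrix ι ι ℂ) :
    (E true X).trace + (E false X).trace = X.trace := by
  simpa [Matrix.trace_add] using hE.tracePreserving X

/-! ### Upper bound over PPT pairs -/

/-- Pairing a PPT Choi operator with partial transposes of positive operators. -/
theorem ppt_trace_nonneg {A₁ B₁ A₂ B₂ : Type*} [Fintype A₁] [Fintype B₁] [Fintype A₂] [Fintype B₂]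
    [DecidableEq A₁] [DecidableEq B₁]
    {E : Matrix (A₁ × B₁) (A₁ × B₁) ℂ →ₗ[ℂ] Matrix (A₂ × B₂) (A₂ × B₂) ℂ}
    (hE : (partialTransposeRight (bipartiteChoi E)).PosSemidef)
    {X : Matrix (A₁ × B₁) (A₁ × B₁) ℂ} {Y : Matrix (A₂ × B₂) (A₂ × B₂) ℂ}
    (hX : X.PosSemidef) (hY : Y.PosSemidef) :
    0 ≤ (E (partialTransposeRight X).transpose * partialTransposeRight Y).trace := by
  have h := posSemidef_trace_mul_nonneg hE (posSemidef_regroup.2 (hX.kronecker hY))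
  rwa [trace_partialTransposeRight_mul, partialTransposeRight_regroup_kronecker,
    show bipartiteChoi E = regroup (choi E) from rfl, trace_regroup_mul,
    trace_choi_mul_kronecker] at h

theorem le_of_mem_pptSuccessProbs {d : ℕ} (hd : 2 ≤ d) {p : ℝ}
    (hp : p ∈ pptSuccessProbs (wernerState d) singlet) : p ≤ 2 / d := by
  obtain ⟨E, hE, h⟩ := hp
  have hD := apply_one_sub_swapOp hd h
  have hd0 : 0 < d := by lia
  -- These three pairings are the dual certificate. With x, y, z as named below they read y ≤ 2x, y
  -- ≤ dz, and nonnegativity of the failure trace on F, which with `e4` becomes x ≤ d.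
  have e1 := ppt_trace_nonneg (hE.ppt true).2.2.1 (maxEnt_posSemidef d)
    (natCast_sub_maxEnt_posSemidef two_pos)
  have e2 := ppt_trace_nonneg (hE.ppt true).2.2.1 (natCast_sub_maxEnt_posSemidef hd0)
    (maxEnt_posSemidef 2)
  have e3 := ppt_trace_nonneg (hE.ppt false).2.2.1 (maxEnt_posSemidef d)
    Matrix.PosSemidef.one
  have e4 := hE.isInstrument.trace_add (swapOp d)
  have e5 : (E true 1 * swapOp 2).trace - (E true (swapOp d) * swapOp 2).trace =
      -((d : ℂ) * (d - 1) * p) := by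
    rw [← Matrix.trace_sub, ← Matrix.sub_mul, ← map_sub, hD, singlet_eq_antisymProj, antisymProj,
      Matrix.smul_mul, Matrix.smul_mul, Matrix.sub_mul, swapOp_mul_self]
    simp only [Matrix.one_mul, Matrix.trace_smul, Matrix.trace_sub, trace_swapOp, trace_one_prod,
      smul_eq_mul]
    push_cast
    ring
  simp only [partialTransposeRight_sub, partialTransposeRight_smul, partialTransposeRight_one,
    partialTransposeRight_maxEnt, swapOp_transpose, Matrix.transpose_sub, Matrix.transpose_smul,
    Matrix.transpose_one, map_sub, map_smul, Matrix.sub_mul, Matrix.mul_sub, Matrix.smul_mul,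
    Matrix.mul_smul, Matrix.mul_one, Matrix.trace_sub, Matrix.trace_smul, smul_eq_mul,
    trace_swapOp] at e1 e2 e3 e4
  rw [Complex.le_def] at e1 e2 e3
  replace e1 := e1.1
  replace e2 := e2.1
  replace e3 := e3.1
  replace e4 := congrArg Complex.re e4
  replace e5 := congrArg Complex.re e5
  have hre (n : ℕ) (z : ℂ) : (n * z).re = n * z.re := by simp
  have e6 : ((d : ℂ) * (d - 1) * p).re = d * (d - 1) * p := by
    rw [show (d : ℂ) * (d - 1) * p = ((d * (d - 1) * p : ℝ) : ℂ) by push_cast; rfl,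
      Complex.ofReal_re]
  simp only [Complex.neg_re, e6, Complex.sub_re, Complex.add_re, Complex.natCast_re,
    Complex.zero_re, hre] at e1 e2 e3 e4 e5
  have hd1 : (2 : ℝ) ≤ d := by exact_mod_cast hd
  rw [le_div_iff₀ (by linarith)]
  push_cast at *
  generalize (E true (swapOp d)).trace.re = x at *
  generalize (E true (swapOp d) * swapOp 2).trace.re = y at *
  generalize (E true 1 * swapOp 2).trace.re = z at *
  have h1 : y ≤ 2 * d := by linarith
  -- Substituting z = y - d(d-1)p into y ≤ dz gives d²(d-1)p ≤ (d-1)y, and y ≤ 2d finishes.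
  have h2 : ((d : ℝ) - 1) * (d * (p * d)) ≤ (d - 1) * (d * 2) := by
    nlinarith
  exact le_of_mul_le_mul_left (le_of_mul_le_mul_left h2 (by linarith)) (by linarith)

/-! ### An optimal PPT pair -/

/-- The Choi operator of the success map of the optimal PPT distillation protocol. -/
def pptSuccChoi (d : ℕ) :
    Matrix ((Fin d × Fin d) × (Fin 2 × Fin 2)) ((Fin d × Fin d) × (Fin 2 × Fin 2)) ℂ :=
  (1 / (2 * d * (d + 1)) : ℝ) • ((2 * d : ℂ) • (1 ⊗ₖ 1) + (-2 : ℂ) • (swapOp d ⊗ₖ 1) +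
    (-d : ℂ) • (1 ⊗ₖ swapOp 2) + (d + 2 : ℂ) • (swapOp d ⊗ₖ swapOp 2))

/-- The Choi operator of the failure map of the optimal PPT distillation protocol. -/
def pptFailChoi (d : ℕ) :
    Matrix ((Fin d × Fin d) × (Fin 2 × Fin 2)) ((Fin d × Fin d) × (Fin 2 × Fin 2)) ℂ :=
  ((d - 2) / (d * (d + 1)) : ℝ) •
    (((d : ℂ) • 1 - swapOp d) ⊗ₖ Matrix.single ((0, 0) : Fin 2 × Fin 2) (0, 0) (1 : ℂ))

/-- In the symmetric/antisymmetric basis all coefficients are nonnegative for d ≥ 2. The missing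
term (1 - F) ⊗ (1 + F') is the zero-error condition. -/
theorem pptSuccChoi_eq (d : ℕ) :
    pptSuccChoi d = (1 / (2 * d * (d + 1)) : ℝ) • ((d + 1 : ℝ) •
      ((1 - swapOp d) ⊗ₖ (1 - swapOp 2)) + ((d - 2) / 2 : ℝ) •
      ((1 + swapOp d) ⊗ₖ (1 - swapOp 2)) + (d / 2 : ℝ) •
      ((1 + swapOp d) ⊗ₖ (1 + swapOp 2))) := by
  rw [pptSuccChoi]
  congr 1
  ext ⟨i, k⟩ ⟨j, l⟩
  simp only [Matrix.add_apply, Matrix.smul_apply, Matrix.kroneckerMap_apply, Matrix.sub_apply,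
    smul_eq_mul, Complex.real_smul]
  push_cast
  ring

theorem single_posSemidef {n : Type*} [Fintype n] [DecidableEq n] (i : n) :
    (Matrix.single i i (1 : ℂ)).PosSemidef := by
  rw [← Matrix.diagonal_single]
  exact Matrix.PosSemidef.diagonal fun j => by
    simp only [Pi.single_apply]; split_ifs <;> simp

theorem partialTransposeRight_single_self {α β : Type*} [DecidableEq α] [DecidableEq β]
    (i : α × β) :
    partialTransposeRight (Matrix.single i i (1 : ℂ)) = Matrix.single i i 1 := by
  ext ⟨a, b⟩ ⟨c, e⟩
  obtain ⟨i, j⟩ := i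
  simp only [partialTransposeRight, Matrix.single_apply, Matrix.of_apply, Prod.mk.injEq]
  congr 1
  grind

theorem natCast_sub_swapOp_posSemidef {d : ℕ} (hd : 0 < d) :
    ((d : ℂ) • 1 - swapOp d).PosSemidef := by
  have h : (d : ℂ) • 1 - swapOp d = (d - 1 : ℝ) • 1 + (1 - swapOp d) := by
    rw [← Complex.coe_smul]
    push_cast
    module
  have h1 : (1 : ℝ) ≤ d := by exact_mod_cast hd
  rw [h]
  exact (Matrix.PosSemidef.one.smul (by linarith)).add (one_sub_swapOp_posSemidef d)

theorem pptSuccChoi_posSemidef {d : ℕ} (hd : 2 ≤ d) : (pptSuccChoi d).PosSemidef := by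
  have hd1 : (2 : ℝ) ≤ d := by exact_mod_cast hd
  rw [pptSuccChoi_eq]
  refine Matrix.PosSemidef.smul (.add (.add ?_ ?_) ?_) (by positivity)
  · exact ((one_sub_swapOp_posSemidef d).kronecker (one_sub_swapOp_posSemidef 2)).smul
      (by positivity)
  · exact ((one_add_swapOp_posSemidef d).kronecker (one_sub_swapOp_posSemidef 2)).smul
      (by linarith)
  · exact ((one_add_swapOp_posSemidef d).kronecker (one_add_swapOp_posSemidef 2)).smul
      (by positivity)

theorem pptFailChoi_posSemidef {d : ℕ} (hd : 2 ≤ d) : (pptFailChoi d).PosSemidef := by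
  have hd1 : (2 : ℝ) ≤ d := by exact_mod_cast hd
  exact ((natCast_sub_swapOp_posSemidef (by lia)).kronecker (single_posSemidef _)).smul
    (div_nonneg (by linarith) (by positivity))

/-- The terms Φ ⊗ (2 - Φ') and (d - Φ) ⊗ Φ' are absent: this is complementary slackness with the two
success-map pairings of the upper bound. -/
theorem partialTransposeRight_pptSuccChoi (d : ℕ) :
    partialTransposeRight (regroup (pptSuccChoi d)) = regroup ((1 / (2 * d * (d + 1)) : ℝ) •
      (((d : ℂ) • 1 - maxEnt d) ⊗ₖ (((2 : ℕ) : ℂ) • 1 - maxEnt 2) +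
        (d + 1 : ℝ) • (maxEnt d ⊗ₖ maxEnt 2))) := by
  rw [pptSuccChoi, ← Complex.coe_smul, ← Complex.coe_smul]
  simp only [regroup_add, regroup_smul, partialTransposeRight_add, partialTransposeRight_smul,
    partialTransposeRight_regroup_kronecker, partialTransposeRight_swapOp,
    partialTransposeRight_one]
  simp only [← regroup_smul, ← regroup_add]
  congr 2
  ext ⟨i, k⟩ ⟨j, l⟩
  simp only [Matrix.add_apply, Matrix.smul_apply, Matrix.kroneckerMap_apply, Matrix.sub_apply,
    smul_eq_mul, Complex.real_smul]
  push_cast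
  ring

theorem partialTransposeRight_pptFailChoi (d : ℕ) :
    partialTransposeRight (regroup (pptFailChoi d)) =
      regroup (((d - 2) / (d * (d + 1)) : ℝ) • (((d : ℂ) • 1 - maxEnt d) ⊗ₖ
        Matrix.single ((0, 0) : Fin 2 × Fin 2) (0, 0) (1 : ℂ))) := by
  rw [pptFailChoi, ← Complex.coe_smul, ← Complex.coe_smul, regroup_smul, regroup_smul,
    partialTransposeRight_smul, partialTransposeRight_regroup_kronecker,
    partialTransposeRight_sub, partialTransposeRight_smul, partialTransposeRight_one,
    partialTransposeRight_swapOp, partialTransposeRight_single_self]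

/-- The left partial transpose is the full transpose of the right one, and transposition preserves
positivity. -/
theorem mem_pptCone_of {α β : Type*} {M : Matrix (α × β) (α × β) ℂ} (h : M.PosSemidef)
    (h' : (partialTransposeRight M).PosSemidef) : M ∈ pptCone α β :=
  ⟨h, h'.transpose, h', h.transpose⟩

theorem pptSuccChoi_mem {d : ℕ} (hd : 2 ≤ d) :
    regroup (pptSuccChoi d) ∈ pptCone (Fin d × Fin 2) (Fin d × Fin 2) := by
  refine mem_pptCone_of (posSemidef_regroup.2 (pptSuccChoi_posSemidef hd)) ?_
  rw [partialTransposeRight_pptSuccChoi, posSemidef_regroup]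
  exact (((natCast_sub_maxEnt_posSemidef (by lia)).kronecker
    (natCast_sub_maxEnt_posSemidef two_pos)).add
    (((maxEnt_posSemidef d).kronecker (maxEnt_posSemidef 2)).smul (by positivity))).smul
    (by positivity)

theorem pptFailChoi_mem {d : ℕ} (hd : 2 ≤ d) :
    regroup (pptFailChoi d) ∈ pptCone (Fin d × Fin 2) (Fin d × Fin 2) := by
  have hd1 : (2 : ℝ) ≤ d := by exact_mod_cast hd
  refine mem_pptCone_of (posSemidef_regroup.2 (pptFailChoi_posSemidef hd)) ?_
  rw [partialTransposeRight_pptFailChoi, posSemidef_regroup]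
  exact ((natCast_sub_maxEnt_posSemidef (by lia)).kronecker (single_posSemidef _)).smul
    (div_nonneg (by linarith) (by positivity))

theorem ofChoi_pptSuccChoi (d : ℕ) (X : Matrix (Fin d × Fin d) (Fin d × Fin d) ℂ) :
    ofChoi (pptSuccChoi d) X = (1 / (2 * d * (d + 1)) : ℂ) •
      ((2 * d * X.trace - 2 * (X * swapOp d).trace) • 1 +
        (-d * X.trace + (d + 2) * (X * swapOp d).trace) • swapOp 2) := by
  rw [pptSuccChoi, ← Complex.coe_smul]
  simp only [ofChoi_smul, ofChoi_add, ofChoi_kronecker, swapOp_transpose, Matrix.transpose_one,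
    Matrix.mul_one]
  push_cast
  module

theorem ofChoi_pptFailChoi (d : ℕ) (X : Matrix (Fin d × Fin d) (Fin d × Fin d) ℂ) :
    ofChoi (pptFailChoi d) X = ((d - 2) / (d * (d + 1)) : ℂ) •
      (d * X.trace - (X * swapOp d).trace) • Matrix.single (0, 0) (0, 0) 1 := by
  rw [pptFailChoi, ← Complex.coe_smul]
  simp only [ofChoi_smul, ofChoi_kronecker, swapOp_transpose, Matrix.transpose_one,
    Matrix.transpose_sub, Matrix.transpose_smul, Matrix.mul_sub, Matrix.mul_smul,
    Matrix.mul_one, Matrix.trace_sub, Matrix.trace_smul, smul_eq_mul]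
  push_cast
  rfl

theorem mem_pptSuccessProbs {d : ℕ} (hd : 2 ≤ d) :
    2 / (d : ℝ) ∈ pptSuccessProbs (wernerState d) singlet := by
  have h0 : (d : ℂ) ≠ 0 := by exact_mod_cast (by lia : d ≠ 0)
  have h1 : (d : ℂ) - 1 ≠ 0 := sub_ne_zero.2 (by exact_mod_cast (by lia : d ≠ 1))
  have h2 : (d : ℂ) + 1 ≠ 0 := by exact_mod_cast (by lia : d + 1 ≠ 0)
  refine ⟨fun m => ofChoi (if m then pptSuccChoi d else pptFailChoi d), ⟨⟨?_, ?_⟩, ?_⟩, ?_⟩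
  · rintro (_ | _)
    · simpa [choi_ofChoi] using pptFailChoi_posSemidef hd
    · simpa [choi_ofChoi] using pptSuccChoi_posSemidef hd
  · intro X
    simp only [Fintype.sum_bool, if_true, Bool.false_eq_true, if_false, ofChoi_pptSuccChoi,
      ofChoi_pptFailChoi, Matrix.trace_add, Matrix.trace_smul, trace_swapOp, trace_one_prod,
      Matrix.trace_single_eq_same, smul_eq_mul]
    push_cast
    field_simp
    ring
  · rintro (_ | _)
    · have := pptFailChoi_mem hd
      simpa [bipartiteChoi, choi_ofChoi, regroup] using this
    · have := pptSuccChoi_mem hd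
      simpa [bipartiteChoi, choi_ofChoi, regroup] using this
  · have e1 : (wernerState d).trace = 1 := by
      rw [wernerState, antisymProj, Matrix.trace_smul, Matrix.trace_smul, Matrix.trace_sub,
        trace_swapOp, trace_one_prod]
      simp only [smul_eq_mul]
      field_simp
    have e2 : (wernerState d * swapOp d).trace = -1 := by
      rw [← e1, ← Matrix.trace_neg]
      congr 1
      rw [wernerState, antisymProj, Matrix.smul_mul, Matrix.smul_mul, Matrix.sub_mul,
        swapOp_mul_self, Matrix.one_mul]
      module
    simp only [if_true, ofChoi_pptSuccChoi, e1, e2, singlet_eq_antisymProj, antisymProj]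
    ext i j
    simp only [Matrix.add_apply, Matrix.smul_apply, Matrix.sub_apply, smul_eq_mul]
    push_cast
    field_simp
    ring

/-! ### An optimal separable pair -/

theorem sum_mem_sepCone {α β ι : Type*} (s : Finset ι) {c : ι → ℝ}
    (hc : ∀ x ∈ s, 0 ≤ c x) (a : ι → α → ℂ) (b : ι → β → ℂ) :
    ∑ x ∈ s, (c x : ℂ) • ketbra (prodVec (a x) (b x)) ∈ sepCone α β := by
  -- The cone has no weights, so the square root of each weight is absorbed into Alice's vector.
  refine ⟨s.card, fun k => ((Real.sqrt (c (s.equivFin.symm k)) : ℝ) : ℂ) • a (s.equivFin.symm k),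
    fun k => b (s.equivFin.symm k), ?_⟩
  rw [← Finset.sum_coe_sort, ← Equiv.sum_comp s.equivFin.symm]
  refine Finset.sum_congr rfl fun k _ => ?_
  have h : ((Real.sqrt (c (s.equivFin.symm k)) : ℝ) : ℂ) *
      ((Real.sqrt (c (s.equivFin.symm k)) : ℝ) : ℂ) = c (s.equivFin.symm k) := by
    rw [← Complex.ofReal_mul, Real.mul_self_sqrt (hc _ (s.equivFin.symm k).2)]
  ext i j
  simp only [← h, ketbra, prodVec, Matrix.vecMulVec_apply, Matrix.smul_apply, Pi.smul_apply,
    smul_eq_mul, Pi.star_apply, star_mul', Complex.star_def, Complex.conj_ofReal]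
  ring

theorem posSemidef_of_mem_sepCone {α β : Type*} [Finite α] [Finite β]
    {M : Matrix (α × β) (α × β) ℂ} (h : M ∈ sepCone α β) : M.PosSemidef := by
  obtain ⟨n, a, b, rfl⟩ := h
  exact Matrix.posSemidef_sum _ fun k _ => Matrix.posSemidef_vecMulVec_self_star _

/-- The success map of the optimal separable protocol: Alice and Bob both project onto the span
of the same two basis vectors. -/
def sepSucc (d : ℕ) :
    Matrix (Fin d × Fin d) (Fin d × Fin d) ℂ →ₗ[ℂ] Matrix (Fin 2 × Fin 2) (Fin 2 × Fin 2) ℂ where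
  toFun X := ∑ f ∈ Finset.univ.offDiag, ((1 / (2 * (d - 1)) : ℝ) : ℂ) •
    X.submatrix (Prod.map ![f.1, f.2] ![f.1, f.2]) (Prod.map ![f.1, f.2] ![f.1, f.2])
  map_add' X Y := by
    simp [Matrix.submatrix_add, Finset.sum_add_distrib]
  map_smul' c X := by
    rw [Finset.smul_sum]
    exact Finset.sum_congr rfl fun f _ => by
      rw [Matrix.submatrix_smul, Pi.smul_apply, Pi.smul_apply, smul_comm]; rfl

/-- The failure map of the optimal separable protocol: measure in the computational basis and
prepare a fixed product state. -/
def sepFail (d : ℕ) :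
    Matrix (Fin d × Fin d) (Fin d × Fin d) ℂ →ₗ[ℂ] Matrix (Fin 2 × Fin 2) (Fin 2 × Fin 2) ℂ where
  toFun X := ∑ f ∈ Finset.univ.offDiag, (((d - 2) / (d - 1) : ℝ) : ℂ) •
    X f f • Matrix.single (0, 0) (0, 0) 1
  map_add' X Y := by
    simp only [Matrix.add_apply, add_smul, smul_add, Finset.sum_add_distrib]
  map_smul' c X := by
    rw [Finset.smul_sum]
    exact Finset.sum_congr rfl fun f _ => by
      rw [Matrix.smul_apply, smul_assoc, smul_comm]; rfl

theorem bipartiteChoi_sepSucc (d : ℕ) :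
    bipartiteChoi (sepSucc d) = ∑ f ∈ Finset.univ.offDiag, ((1 / (2 * (d - 1)) : ℝ) : ℂ) •
      ketbra (prodVec (fun x : Fin d × Fin 2 => if x.1 = ![f.1, f.2] x.2 then 1 else 0)
        (fun x : Fin d × Fin 2 => if x.1 = ![f.1, f.2] x.2 then 1 else 0)) := by
  ext ⟨⟨i, k⟩, ⟨i', k'⟩⟩ ⟨⟨j, l⟩, ⟨j', l'⟩⟩
  change choi (sepSucc d) ((i, i'), (k, k')) ((j, j'), (l, l')) = _
  rw [choi_apply]
  simp only [sepSucc, LinearMap.coe_mk, AddHom.coe_mk, Matrix.sum_apply, Matrix.smul_apply,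
    Matrix.submatrix_apply, Prod.map, Matrix.single_apply, ketbra, prodVec,
    Matrix.vecMulVec_apply, Pi.star_apply, Prod.mk.injEq, apply_ite star, star_one,
    star_zero, ite_and, mul_ite, mul_one, mul_zero]
  refine Finset.sum_congr rfl fun f _ => ?_
  split_ifs <;> rfl

theorem bipartiteChoi_sepFail (d : ℕ) :
    bipartiteChoi (sepFail d) = ∑ f ∈ Finset.univ.offDiag, (((d - 2) / (d - 1) : ℝ) : ℂ) •
      ketbra (prodVec (fun x : Fin d × Fin 2 => if x = (f.1, 0) then 1 else 0)
        (fun x : Fin d × Fin 2 => if x = (f.2, 0) then 1 else 0)) := by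
  ext ⟨⟨i, k⟩, ⟨i', k'⟩⟩ ⟨⟨j, l⟩, ⟨j', l'⟩⟩
  change choi (sepFail d) ((i, i'), (k, k')) ((j, j'), (l, l')) = _
  rw [choi_apply]
  simp only [sepFail, LinearMap.coe_mk, AddHom.coe_mk, Matrix.sum_apply, Matrix.smul_apply,
    Matrix.single_apply, ketbra, prodVec, Matrix.vecMulVec_apply, Pi.star_apply, star_mul',
    apply_ite star, star_one, star_zero, smul_eq_mul]
  refine Finset.sum_congr rfl fun f _ => ?_
  obtain ⟨p, q⟩ := f
  simp only [Prod.mk.injEq, eq_comm (a := (0 : Fin 2)), ite_and, mul_ite, mul_one, mul_zero]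
  split_ifs <;> rfl

theorem bipartiteChoi_sepSucc_mem {d : ℕ} (hd : 2 ≤ d) :
    bipartiteChoi (sepSucc d) ∈ sepCone (Fin d × Fin 2) (Fin d × Fin 2) := by
  have h : (2 : ℝ) ≤ d := by exact_mod_cast hd
  rw [bipartiteChoi_sepSucc]
  exact sum_mem_sepCone _ (fun _ _ => div_nonneg zero_le_one (by linarith)) _ _

theorem bipartiteChoi_sepFail_mem {d : ℕ} (hd : 2 ≤ d) :
    bipartiteChoi (sepFail d) ∈ sepCone (Fin d × Fin 2) (Fin d × Fin 2) := by
  have h : (2 : ℝ) ≤ d := by exact_mod_cast hd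
  rw [bipartiteChoi_sepFail]
  exact sum_mem_sepCone _ (fun _ _ => div_nonneg (by linarith) (by linarith)) _ _

theorem sum_offDiag_eq {ι M : Type*} [Fintype ι] [DecidableEq ι] [AddCommGroup M]
    (g : ι × ι → M) : ∑ f ∈ Finset.univ.offDiag, g f = ∑ f, g f - ∑ i, g (i, i) := by
  rw [eq_sub_iff_add_eq, ← Finset.univ_product_univ, ← Finset.diag_union_offDiag,
    Finset.sum_union (Finset.disjoint_diag_offDiag _), Finset.sum_diag, add_comm]

/-- A vector |ii⟩ survives for 2(d-1) ordered pairs, which fixes the weight 1/(2(d-1)). For i ≠ j,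
|ij⟩ survives for only two, and the failure map supplies the deficit (d-2)/(d-1). -/
theorem trace_sepSucc_add_sepFail {d : ℕ} (hd : 2 ≤ d)
    (X : Matrix (Fin d × Fin d) (Fin d × Fin d) ℂ) :
    (sepSucc d X).trace + (sepFail d X).trace = X.trace := by
  have h1 : (d : ℂ) - 1 ≠ 0 := sub_ne_zero.2 (by exact_mod_cast (by lia : d ≠ 1))
  simp only [sepSucc, sepFail, LinearMap.coe_mk, AddHom.coe_mk, Matrix.trace_sum,
    Matrix.trace_smul, Matrix.trace_single_eq_same]
  simp only [sum_offDiag_eq, Matrix.trace, Matrix.diag_apply, Matrix.submatrix_apply, Prod.map,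
    Fintype.sum_prod_type, Fin.sum_univ_two, Matrix.cons_val_zero, Matrix.cons_val_one,
    smul_eq_mul, mul_one, ← Finset.mul_sum, Finset.sum_add_distrib, Finset.sum_const,
    Finset.card_univ, Fintype.card_fin, nsmul_eq_mul]
  rw [Finset.sum_comm (f := fun i j => X (j, i) (j, i))]
  push_cast
  field_simp
  ring

theorem antisymProj_submatrix {d : ℕ} {p q : Fin d} (h : p ≠ q) :
    (antisymProj d).submatrix (Prod.map ![p, q] ![p, q]) (Prod.map ![p, q] ![p, q]) =
      antisymProj 2 := by
  have hinj : Function.Injective ![p, q] := by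
    intro i j
    fin_cases i <;> fin_cases j <;> simp [h, h.symm]
  ext ⟨i, j⟩ ⟨k, l⟩
  simp [antisymProj, swapOp, Matrix.one_apply, hinj.eq_iff]

theorem mem_sepSuccessProbs {d : ℕ} (hd : 2 ≤ d) :
    1 / ((d : ℝ) - 1) ∈ sepSuccessProbs (wernerState d) singlet := by
  have h0 : (d : ℂ) ≠ 0 := by exact_mod_cast (by lia : d ≠ 0)
  have h1 : (d : ℂ) - 1 ≠ 0 := sub_ne_zero.2 (by exact_mod_cast (by lia : d ≠ 1))
  have hsep : ∀ m : Bool, bipartiteChoi (if m then sepSucc d else sepFail d) ∈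
      sepCone (Fin d × Fin 2) (Fin d × Fin 2) := by
    rintro (_ | _)
    · exact bipartiteChoi_sepFail_mem hd
    · exact bipartiteChoi_sepSucc_mem hd
  refine ⟨fun m => if m then sepSucc d else sepFail d, ⟨⟨fun m => ?_, fun X => ?_⟩, hsep⟩, ?_⟩
  · exact posSemidef_regroup.1 (posSemidef_of_mem_sepCone (hsep m))
  · simpa [Matrix.trace_add] using trace_sepSucc_add_sepFail hd X
  · have h2 : sepSucc d (wernerState d) = ∑ f ∈ (Finset.univ : Finset (Fin d)).offDiag,
        ((1 / (2 * (d - 1)) : ℝ) : ℂ) • (2 / ((d : ℂ) * ((d : ℂ) - 1))) • singlet := by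
      simp only [sepSucc, LinearMap.coe_mk, AddHom.coe_mk]
      refine Finset.sum_congr rfl fun f hf => ?_
      rw [singlet_eq_antisymProj, ← antisymProj_submatrix (Finset.mem_offDiag.1 hf).2.2]
      rfl
    simp only [if_true]
    -- There are d² - d ordered pairs, all contributing the same multiple of the singlet.
    rw [h2, Finset.sum_const, Finset.offDiag_card, Finset.card_univ, Fintype.card_fin,
      ← Nat.cast_smul_eq_nsmul ℂ, smul_smul, smul_smul, Nat.cast_sub (Nat.le_mul_self d)]
    congr 1
    push_cast
    field_simp

/-! ### Upper bound over separable pairs -/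

/-- The component of a separable map given by the operator `A ⊗ B`, where `A` and `B` have the
matrix entries `a` and `b`. -/
def sepTerm {m : Type*} [Fintype m] {κ κ' : Type*} (a : m × κ → ℂ) (b : m × κ' → ℂ)
    (X : Matrix (m × m) (m × m) ℂ) : Matrix (κ × κ') (κ × κ') ℂ :=
  Matrix.of fun k l => ∑ i, ∑ j, X i j *
    (a (i.1, k.1) * b (i.2, k.2) * star (a (j.1, l.1) * b (j.2, l.2)))

theorem apply_eq_sum_sepTerm {m κ κ' : Type*} [Fintype m] [DecidableEq m]
    {E : Matrix (m × m) (m × m) ℂ →ₗ[ℂ] Matrix (κ × κ') (κ × κ') ℂ} {n : ℕ}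
    {a : Fin n → m × κ → ℂ} {b : Fin n → m × κ' → ℂ}
    (h : bipartiteChoi E = ∑ x, ketbra (prodVec (a x) (b x))) (X : Matrix (m × m) (m × m) ℂ) :
    E X = ∑ x, sepTerm (a x) (b x) X := by
  ext k l
  have hc (i j : m × m) : choi E (i, k) (j, l) =
      ∑ x, a x (i.1, k.1) * b x (i.2, k.2) * star (a x (j.1, l.1) * b x (j.2, l.2)) := by
    have := congrFun (congrFun h ((i.1, k.1), (i.2, k.2))) ((j.1, l.1), (j.2, l.2))
    rw [Matrix.sum_apply] at this
    exact this
  rw [apply_eq_sum_choi, Matrix.sum_apply]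
  simp only [hc, sepTerm, Matrix.of_apply, Finset.mul_sum]
  simp only [Finset.sum_comm (s := (Finset.univ : Finset (m × m)))
    (t := (Finset.univ : Finset (Fin n)))]

/-- The antisymmetrization of `a ⊗ b` in the input indices. -/
def wedge {m κ κ' : Type*} (a : m × κ → ℂ) (b : m × κ' → ℂ) (i i' : m) : κ × κ' → ℂ :=
  fun k => a (i, k.1) * b (i', k.2) - a (i', k.1) * b (i, k.2)

section

variable {d : ℕ} {κ κ' : Type*} (a : Fin d × κ → ℂ) (b : Fin d × κ' → ℂ)

/-- This reflects 1 - F = ½ ∑ |ii' - i'i⟩⟨ii' - i'i|; the proof averages the sum with its copy under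
i ↔ i'. -/
theorem sepTerm_one_sub_swapOp (k l : κ × κ') :
    sepTerm a b (1 - swapOp d) k l =
      (1 / 2) * ∑ i, ∑ i', wedge a b i i' k * star (wedge a b i i' l) := by
  have h1 : sepTerm a b (1 - swapOp d) k l = ∑ i, ∑ i', (a (i, k.1) * b (i', k.2) *
      star (a (i, l.1) * b (i', l.2)) - a (i, k.1) * b (i', k.2) *
      star (a (i', l.1) * b (i, l.2))) := by
    simp only [sepTerm, Matrix.of_apply, Matrix.sub_apply, sub_mul, Finset.sum_sub_distrib,
      Matrix.one_apply, swapOp, ite_mul, one_mul, zero_mul, Fintype.sum_prod_type,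
      Prod.mk.injEq, Prod.swap_prod_mk, ite_and]
    simp
  rw [h1]
  have h2 := Finset.sum_comm (s := (Finset.univ : Finset (Fin d)))
    (t := (Finset.univ : Finset (Fin d))) (f := fun i i' => (a (i, k.1) * b (i', k.2) *
      star (a (i, l.1) * b (i', l.2)) - a (i, k.1) * b (i', k.2) *
      star (a (i', l.1) * b (i, l.2))))
  rw [← mul_right_inj' (two_ne_zero (α := ℂ)), two_mul]
  nth_rw 2 [h2]
  simp only [← Finset.sum_add_distrib, ← mul_assoc]
  norm_num only
  rw [one_mul]
  refine Finset.sum_congr rfl fun i _ => Finset.sum_congr rfl fun i' _ => ?_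
  simp only [wedge, star_sub, star_mul']
  ring

/-- Although F is not positive, on a product Kraus operator its trace is a squared Hilbert–Schmidt
norm. -/
theorem trace_sepTerm_swapOp [Fintype κ] [Fintype κ'] :
    (sepTerm a b (swapOp d)).trace =
      ∑ k, ∑ k', (∑ i, a (i, k) * star (b (i, k'))) * star (∑ i, a (i, k) * star (b (i, k'))) := by
  simp only [Matrix.trace, Matrix.diag_apply, sepTerm, Matrix.of_apply, Fintype.sum_prod_type,
    swapOp, ite_mul, one_mul, zero_mul, Prod.mk.injEq, Prod.swap_prod_mk, ite_and, star_sum,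
    Finset.sum_mul_sum]
  refine Finset.sum_congr rfl fun k _ => Finset.sum_congr rfl fun k' _ =>
    Finset.sum_congr rfl fun i _ => Finset.sum_congr rfl fun i' _ => ?_
  rw [Finset.sum_eq_single i', Finset.sum_eq_single i]
  · simp
    ring
  · intro j _ hj
    simp [hj.symm]
  · simp
  · intro j _ hj
    simp [hj.symm]
  · simp

theorem trace_sepTerm_swapOp_nonneg [Fintype κ] [Fintype κ'] :
    0 ≤ (sepTerm a b (swapOp d)).trace := by
  rw [trace_sepTerm_swapOp]
  exact Finset.sum_nonneg fun k _ => Finset.sum_nonneg fun k' _ => mul_star_self_nonneg _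

end

/-- If `a ⊗ b` maps antisymmetric vectors to antisymmetric ones, then either it kills them all or
`b` is proportional to `a`. -/
theorem wedge_eq_zero_or_proportional {m : Type*} {a b : m × Fin 2 → ℂ}
    (h00 : ∀ i i', wedge a b i i' (0, 0) = 0) (h11 : ∀ i i', wedge a b i i' (1, 1) = 0)
    (h01 : ∀ i i', wedge a b i i' (0, 1) + wedge a b i i' (1, 0) = 0) :
    (∀ i i' k, wedge a b i i' k = 0) ∨ ∃ c : ℂ, b = c • a := by
  simp only [wedge] at h00 h11 h01
  by_cases h : ∀ i i', wedge a b i i' (0, 1) = 0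
  · left
    rintro i i' ⟨k, k'⟩
    have := h01 i i'
    have h' := h i i'
    simp only [wedge] at h' ⊢
    fin_cases k <;> fin_cases k'
    · exact h00 i i'
    · exact h'
    · rw [h', zero_add] at this
      exact this
    · exact h11 i i'
  · right
    push Not at h
    obtain ⟨p, q, hpq⟩ := h
    simp only [wedge] at hpq
    -- The nonzero (0,1) component involves only a(·,0) and b(·,1), so both have a pivot. The (0,0)
    -- and (1,1) conditions then make b(·,0) = β a(·,0) and a(·,1) = α b(·,1), and the remaining
    -- condition forces αβ = 1.
    obtain ⟨r, hr⟩ : ∃ r, a (r, 0) ≠ 0 := by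
      by_contra! h
      simp [h] at hpq
    obtain ⟨s, hs⟩ : ∃ s, b (s, 1) ≠ 0 := by
      by_contra! h
      simp [h] at hpq
    set β := b (r, 0) / a (r, 0)
    set α := a (s, 1) / b (s, 1)
    have hb0 (i) : b (i, 0) = β * a (i, 0) := by
      have := h00 i r
      simp only [β]
      field_simp
      linear_combination -this
    have ha1 (i) : a (i, 1) = α * b (i, 1) := by
      have := h11 i s
      simp only [α]
      field_simp
      linear_combination this
    have hαβ : α * β = 1 := by
      have := h01 p q
      rw [ha1, ha1, hb0, hb0] at this
      rw [← sub_eq_zero]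
      refine (mul_eq_zero.1 (?_ : (α * β - 1) * _ = 0)).resolve_right hpq
      linear_combination -this
    refine ⟨β, funext ?_⟩
    rintro ⟨i, k⟩
    fin_cases k
    · exact hb0 i
    · simp only [Pi.smul_apply, smul_eq_mul]
      change b (i, 1) = β * a (i, 1)
      rw [ha1]
      linear_combination -b (i, 1) * hαβ

section

variable {d : ℕ} {κ κ' : Type*} [Fintype κ] [Fintype κ'] (a : Fin d × κ → ℂ) (b : Fin d × κ' → ℂ)

theorem trace_sepTerm_one :
    (sepTerm a b (1 : Matrix (Fin d × Fin d) (Fin d × Fin d) ℂ)).trace =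
      ∑ k, ∑ k', (∑ i, a (i, k) * star (a (i, k))) * ∑ i, b (i, k') * star (b (i, k')) := by
  simp only [Matrix.trace, Matrix.diag_apply, sepTerm, Matrix.of_apply, Matrix.one_apply, ite_mul,
    one_mul, zero_mul, Finset.sum_ite_eq, Finset.mem_univ, if_true, Fintype.sum_prod_type,
    Finset.sum_mul_sum, star_mul']
  refine Finset.sum_congr rfl fun k _ => Finset.sum_congr rfl fun k' _ =>
    Finset.sum_congr rfl fun i _ => Finset.sum_congr rfl fun i' _ => by ring

theorem trace_sepTerm_one_sub_swapOp :
    (sepTerm a b (1 - swapOp d)).trace =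
      (sepTerm a b (1 : Matrix (Fin d × Fin d) (Fin d × Fin d) ℂ)).trace -
        (sepTerm a b (swapOp d)).trace := by
  rw [← Matrix.trace_sub]
  congr 1
  ext k l
  simp [sepTerm, sub_mul, Finset.sum_sub_distrib]

end

/-- With g the 2 × 2 Gram matrix of a, the traces on 1 and F are |c|²(tr g)² and |c|² tr g². The
claim is thus (tr g)² ≤ 2 tr g², where 2 is the output dimension. -/
theorem trace_sepTerm_smul_le {d : ℕ} (a : Fin d × Fin 2 → ℂ) (c : ℂ) :
    (sepTerm a (c • a) (1 - swapOp d)).trace ≤ (sepTerm a (c • a) (swapOp d)).trace := by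
  have hstar (k l : Fin 2) :
      star (∑ i, a (i, k) * star (a (i, l))) = ∑ i, a (i, l) * star (a (i, k)) := by
    simp [star_sum, mul_comm]
  have hmul (k l : Fin 2) : ∑ i, a (i, k) * star ((c • a) (i, l)) =
      star c * ∑ i, a (i, k) * star (a (i, l)) := by
    rw [Finset.mul_sum]
    refine Finset.sum_congr rfl fun i _ => ?_
    simp only [Pi.smul_apply, smul_eq_mul, star_mul']
    ring
  have hmul' (k : Fin 2) : ∑ i, (c • a) (i, k) * star ((c • a) (i, k)) =
      c * star c * ∑ i, a (i, k) * star (a (i, k)) := by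
    rw [Finset.mul_sum]
    refine Finset.sum_congr rfl fun i _ => ?_
    simp only [Pi.smul_apply, smul_eq_mul, star_mul']
    ring
  rw [trace_sepTerm_one_sub_swapOp, trace_sepTerm_one, trace_sepTerm_swapOp, ← sub_nonneg]
  simp only [hmul, hmul', star_mul', star_star, hstar, Fin.sum_univ_two]
  set g : Fin 2 → Fin 2 → ℂ := fun k l => ∑ i, a (i, k) * star (a (i, l)) with hg
  have hgs (k l) : star (g k l) = g l k := hstar k l
  -- The bracket is exactly 2 tr g² - (tr g)².
  have key : 0 ≤ c * star c * ((g 0 0 - g 1 1) * star (g 0 0 - g 1 1) +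
      4 * (g 0 1 * star (g 0 1))) :=
    mul_nonneg (mul_star_self_nonneg _) (add_nonneg (mul_star_self_nonneg _)
      (mul_nonneg (by norm_num) (mul_star_self_nonneg _)))
  rw [star_sub, hgs, hgs, hgs] at key
  simp only [hg] at key
  convert key using 1
  ring

theorem trace_sepTerm_le {d : ℕ} {a b : Fin d × Fin 2 → ℂ}
    (h00 : ∀ i i', wedge a b i i' (0, 0) = 0) (h11 : ∀ i i', wedge a b i i' (1, 1) = 0)
    (h01 : ∀ i i', wedge a b i i' (0, 1) + wedge a b i i' (1, 0) = 0) :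
    (sepTerm a b (1 - swapOp d)).trace ≤ (sepTerm a b (swapOp d)).trace := by
  obtain h | ⟨c, rfl⟩ := wedge_eq_zero_or_proportional h00 h11 h01
  · have h0 : (sepTerm a b (1 - swapOp d)).trace = 0 :=
      Finset.sum_eq_zero fun k _ => by simp [sepTerm_one_sub_swapOp, h]
    rw [h0]
    exact trace_sepTerm_swapOp_nonneg a b
  · exact trace_sepTerm_smul_le a c

theorem eq_zero_of_sum_mul_star_eq_zero {ι m : Type*} [Fintype ι] [Fintype m] {f : ι → m → m → ℂ}
    (h : ∑ x, (1 / 2) * ∑ i, ∑ i', f x i i' * star (f x i i') = 0) (x : ι) (i i' : m) :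
    f x i i' = 0 := by
  rw [← Finset.mul_sum] at h
  replace h := (mul_eq_zero.1 h).resolve_left (by norm_num)
  have h3 (x i i') : 0 ≤ f x i i' * star (f x i i') := mul_star_self_nonneg _
  have h2 (x i) : 0 ≤ ∑ i', f x i i' * star (f x i i') := Finset.sum_nonneg fun _ _ => h3 _ _ _
  have h1 (x) : 0 ≤ ∑ i, ∑ i', f x i i' * star (f x i i') := Finset.sum_nonneg fun _ _ => h2 _ _
  rw [Finset.sum_eq_zero_iff_of_nonneg fun _ _ => h1 _] at h
  replace h := h x (Finset.mem_univ _)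
  rw [Finset.sum_eq_zero_iff_of_nonneg fun _ _ => h2 _ _] at h
  replace h := h i (Finset.mem_univ _)
  rw [Finset.sum_eq_zero_iff_of_nonneg fun _ _ => h3 _ _ _] at h
  simpa using h i' (Finset.mem_univ _)

theorem le_of_mem_sepSuccessProbs {d : ℕ} (hd : 2 ≤ d) {p : ℝ}
    (hp : p ∈ sepSuccessProbs (wernerState d) singlet) : p ≤ 1 / ((d : ℝ) - 1) := by
  obtain ⟨E, hE, h⟩ := hp
  have hD := apply_one_sub_swapOp hd h
  obtain ⟨n, a, b, hab⟩ := hE.separable true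
  obtain ⟨n', a', b', hab'⟩ := hE.separable false
  have hentry (k l : Fin 2 × Fin 2) : ∑ x, (1 / 2) * ∑ i, ∑ i', wedge (a x) (b x) i i' k *
      star (wedge (a x) (b x) i i' l) = ((d : ℂ) * (d - 1) * p) * singlet k l := by
    rw [← smul_eq_mul, ← Matrix.smul_apply, ← hD, apply_eq_sum_sepTerm hab, Matrix.sum_apply]
    simp only [sepTerm_one_sub_swapOp]
  -- The singlet has zero expectation in |00⟩, |11⟩ and |01⟩ + |10⟩. Each expectation of the output
  -- is a sum of squared moduli over Kraus terms, so every term vanishes.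
  have h00 := eq_zero_of_sum_mul_star_eq_zero
    (f := fun x i i' => wedge (a x) (b x) i i' (0, 0)) (by
      rw [hentry, singlet_eq_antisymProj]
      simp [antisymProj, swapOp])
  have h11 := eq_zero_of_sum_mul_star_eq_zero
    (f := fun x i i' => wedge (a x) (b x) i i' (1, 1)) (by
      rw [hentry, singlet_eq_antisymProj]
      simp [antisymProj, swapOp])
  have h01 := eq_zero_of_sum_mul_star_eq_zero
    (f := fun x i i' => wedge (a x) (b x) i i' (0, 1) + wedge (a x) (b x) i i' (1, 0)) (by
      simp only [star_add, mul_add, add_mul, Finset.sum_add_distrib]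
      simp only [← mul_add, ← Finset.mul_sum]
      simp only [← Finset.mul_sum] at hentry
      simp only [mul_add, hentry, singlet_eq_antisymProj]
      simp [antisymProj, swapOp])
  have hle : (E true (1 - swapOp d)).trace ≤ (E true (swapOp d)).trace := by
    rw [apply_eq_sum_sepTerm hab, apply_eq_sum_sepTerm hab, Matrix.trace_sum, Matrix.trace_sum]
    exact Finset.sum_le_sum fun x _ => trace_sepTerm_le (h00 x) (h11 x) (h01 x)
  have hfail : 0 ≤ (E false (swapOp d)).trace := by
    rw [apply_eq_sum_sepTerm hab', Matrix.trace_sum]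
    exact Finset.sum_nonneg fun x _ => trace_sepTerm_swapOp_nonneg _ _
  have hsum := hE.isInstrument.trace_add (swapOp d)
  have htrace : (E true (1 - swapOp d)).trace = ((d * (d - 1) * p : ℝ) : ℂ) := by
    rw [hD, Matrix.trace_smul, singlet_eq_antisymProj, antisymProj, Matrix.trace_smul,
      Matrix.trace_sub, trace_swapOp, trace_one_prod]
    push_cast
    simp only [smul_eq_mul]
    ring
  -- The chain is tr S(1 - F) ≤ tr S(F) ≤ tr F = d.
  have hfin : ((d * (d - 1) * p : ℝ) : ℂ) ≤ ((d : ℝ) : ℂ) := by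
    rw [← htrace, Complex.ofReal_natCast, ← trace_swapOp, ← hsum]
    exact hle.trans (le_add_of_nonneg_right hfail)
  rw [Complex.real_le_real] at hfin
  have hd1 : (2 : ℝ) ≤ d := by exact_mod_cast hd
  rw [le_div_iff₀ (by linarith)]
  refine le_of_mul_le_mul_left (?_ : (d : ℝ) * _ ≤ d * 1) (by linarith)
  linarith

end EntDist

end

theorem mainTheorem6 (d : ℕ) (hd : 2 ≤ d) :
    IsGreatest (EntDist.sepSuccessProbs (EntDist.wernerState d) EntDist.singlet)
        (1 / ((d : ℝ) - 1)) ∧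
      IsGreatest (EntDist.pptSuccessProbs (EntDist.wernerState d) EntDist.singlet)
        (2 / (d : ℝ)) :=
  ⟨⟨EntDist.mem_sepSuccessProbs hd, fun _ => EntDist.le_of_mem_sepSuccessProbs hd⟩,
    ⟨EntDist.mem_pptSuccessProbs hd, fun _ => EntDist.le_of_mem_pptSuccessProbs hd⟩⟩
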